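/- Let $\mathbb K\in\{\mathbb R,\mathbb C\}$, $0<r<1$ and $1<p<\infty$. For a scalar sequence $x=(x_k)_{k\ge 0}$ write $$(T(r)x)_n=\sum_{k=n}^{\infty}\binom{k}{n}(1-r)^{n+1}r^{k-n}x_k\qquad(n=0,1,2,\dots)$$ whenever all these series converge, and let $t_p^r$ be the space of all sequences $x$ for which $T(r)x$ exists and lies in $\ell_p$, with $\|x\|_{t_p^r}=\|T(r)x\|_{\ell_p}$, where two sequences $x,x'$ with $\|x-x'\|_{t_p^r}=0$ are identified. Then the normed space $t_p^r$ has the weak fixed point property: for every nonempty, convex, weakly compact set $C\subseteq t_p^r$ and every map $F:C\to C$ with $\|F(x)-F(y)\|\le\|x-y\|$ for all $x,y\in C$, there is an $x\in C$ with $F(x)=x$. -/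

import Mathlib

open Filter Topology
open scoped ENNReal

noncomputable section

/-- The entry `t_{nk}^r` of the Taylor matrix `T(r)` (the circle method of order `r`). -/
def taylorEntry (r : ℝ) (n k : ℕ) : ℝ :=
  if n ≤ k then (k.choose n : ℝ) * (1 - r) ^ (n + 1) * r ^ (k - n) else 0

/-- The `N`-th partial sum of the series `∑_k t_{nk}^r x_k`. -/
def taylorPartialSum {𝕜 : Type*} [RCLike 𝕜] (r : ℝ) (x : ℕ → 𝕜) (n N : ℕ) : 𝕜 :=
  ∑ k ∈ Finset.range N, ((taylorEntry r n k : ℝ) : 𝕜) * x k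

/-- Every series `∑_k t_{nk}^r x_k`, `n = 0, 1, 2, …`, converges (as a limit of partial sums). -/
def HasTaylorTransform {𝕜 : Type*} [RCLike 𝕜] (r : ℝ) (x : ℕ → 𝕜) : Prop :=
  ∀ n, ∃ l : 𝕜, Tendsto (taylorPartialSum r x n) atTop (𝓝 l)

/-- The Taylor transform `T(r)x`; it is only used for `x` with `HasTaylorTransform r x`. -/
def taylorTransform {𝕜 : Type*} [RCLike 𝕜] (r : ℝ) (x : ℕ → 𝕜) (n : ℕ) : 𝕜 :=
  limUnder atTop (taylorPartialSum r x n)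

theorem HasTaylorTransform.tendsto {𝕜 : Type*} [RCLike 𝕜] {r : ℝ} {x : ℕ → 𝕜}
    (h : HasTaylorTransform r x) (n : ℕ) :
    Tendsto (taylorPartialSum r x n) atTop (𝓝 (taylorTransform r x n)) :=
  tendsto_nhds_limUnder (h n)

theorem tendsto_taylorPartialSum_add {𝕜 : Type*} [RCLike 𝕜] {r : ℝ} {x y : ℕ → 𝕜}
    (hx : HasTaylorTransform r x) (hy : HasTaylorTransform r y) (n : ℕ) :
    Tendsto (taylorPartialSum r (x + y) n) atTop
      (𝓝 (taylorTransform r x n + taylorTransform r y n)) := by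
  have h := (hx.tendsto n).add (hy.tendsto n)
  refine h.congr fun N => ?_
  simp [taylorPartialSum, mul_add, Finset.sum_add_distrib]

theorem tendsto_taylorPartialSum_smul {𝕜 : Type*} [RCLike 𝕜] {r : ℝ} (c : 𝕜) {x : ℕ → 𝕜}
    (hx : HasTaylorTransform r x) (n : ℕ) :
    Tendsto (taylorPartialSum r (c • x) n) atTop (𝓝 (c * taylorTransform r x n)) := by
  have h := (hx.tendsto n).const_mul c
  refine h.congr fun N => ?_
  simp only [taylorPartialSum, Finset.mul_sum, Pi.smul_apply, smul_eq_mul]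
  exact Finset.sum_congr rfl fun k _ => by ring

theorem tendsto_taylorPartialSum_zero {𝕜 : Type*} [RCLike 𝕜] (r : ℝ) (n : ℕ) :
    Tendsto (taylorPartialSum r (0 : ℕ → 𝕜) n) atTop (𝓝 0) := by
  refine tendsto_const_nhds.congr fun N => ?_
  simp [taylorPartialSum]

theorem taylorTransform_add {𝕜 : Type*} [RCLike 𝕜] {r : ℝ} {x y : ℕ → 𝕜}
    (hx : HasTaylorTransform r x) (hy : HasTaylorTransform r y) :
    taylorTransform r (x + y) = taylorTransform r x + taylorTransform r y :=
  funext fun n => (tendsto_taylorPartialSum_add hx hy n).limUnder_eq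

theorem taylorTransform_smul {𝕜 : Type*} [RCLike 𝕜] {r : ℝ} (c : 𝕜) {x : ℕ → 𝕜}
    (hx : HasTaylorTransform r x) :
    taylorTransform r (c • x) = c • taylorTransform r x :=
  funext fun n => (tendsto_taylorPartialSum_smul c hx n).limUnder_eq

theorem taylorTransform_zero {𝕜 : Type*} [RCLike 𝕜] (r : ℝ) :
    taylorTransform r (0 : ℕ → 𝕜) = 0 :=
  funext fun n => (tendsto_taylorPartialSum_zero r n).limUnder_eq

/-- The set `t_p^r` of all scalar sequences whose Taylor transform exists and lies in `ℓ_p`, as a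
linear subspace of the space of all sequences. -/
def taylorSubmodule (𝕜 : Type*) [RCLike 𝕜] (r : ℝ) (p : ℝ≥0∞) : Submodule 𝕜 (ℕ → 𝕜) where
  carrier := {x | HasTaylorTransform r x ∧ Memℓp (taylorTransform r x) p}
  zero_mem' := ⟨fun n => ⟨0, tendsto_taylorPartialSum_zero r n⟩, by
    rw [taylorTransform_zero]; exact zero_memℓp⟩
  add_mem' := fun {x y} hx hy =>
    ⟨fun n => ⟨_, tendsto_taylorPartialSum_add hx.1 hy.1 n⟩, by
      rw [taylorTransform_add hx.1 hy.1]; exact hx.2.add hy.2⟩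
  smul_mem' := fun c x hx =>
    ⟨fun n => ⟨_, tendsto_taylorPartialSum_smul c hx.1 n⟩, by
      rw [taylorTransform_smul c hx.1]; exact hx.2.const_smul c⟩

/-- The sequences in `t_p^r`, as a type of its own: its topology comes from
`‖x‖ = ‖T(r)x‖_{ℓ_p}` and not from the product topology on sequences. -/
def TaylorSeq (𝕜 : Type*) [RCLike 𝕜] (r : ℝ) (p : ℝ≥0∞) : Type _ :=
  taylorSubmodule 𝕜 r p

instance (𝕜 : Type*) [RCLike 𝕜] (r : ℝ) (p : ℝ≥0∞) : AddCommGroup (TaylorSeq 𝕜 r p) :=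
  inferInstanceAs (AddCommGroup (taylorSubmodule 𝕜 r p))

instance (𝕜 : Type*) [RCLike 𝕜] (r : ℝ) (p : ℝ≥0∞) : Module 𝕜 (TaylorSeq 𝕜 r p) :=
  inferInstanceAs (Module 𝕜 (taylorSubmodule 𝕜 r p))

/-- The linear map `x ↦ T(r)x` from `t_p^r` to `ℓ_p`. -/
def TaylorSeq.toLp (𝕜 : Type*) [RCLike 𝕜] (r : ℝ) (p : ℝ≥0∞) :
    TaylorSeq 𝕜 r p →ₗ[𝕜] lp (fun _ : ℕ => 𝕜) p where
  toFun x := ⟨taylorTransform r x.1, x.2.2⟩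
  map_add' x y := Subtype.ext (taylorTransform_add x.2.1 y.2.1)
  map_smul' c x := Subtype.ext (taylorTransform_smul c x.2.1)

/-- `‖x‖ = ‖T(r)x‖_{ℓ_p}` on `t_p^r`. -/
instance (𝕜 : Type*) [RCLike 𝕜] (r : ℝ) (p : ℝ≥0∞) [Fact (1 ≤ p)] :
    SeminormedAddCommGroup (TaylorSeq 𝕜 r p) :=
  SeminormedAddCommGroup.induced _ _ (TaylorSeq.toLp 𝕜 r p)

instance (𝕜 : Type*) [RCLike 𝕜] (r : ℝ) (p : ℝ≥0∞) [Fact (1 ≤ p)] :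
    NormedSpace 𝕜 (TaylorSeq 𝕜 r p) :=
  NormedSpace.induced 𝕜 (TaylorSeq 𝕜 r p) (lp (fun _ : ℕ => 𝕜) p) (TaylorSeq.toLp 𝕜 r p)

/-- The normed space `t_p^r`: sequences `x`, `x'` with `‖x - x'‖ = ‖T(r)(x - x')‖_{ℓ_p} = 0` are
identified. (There are nonzero sequences whose Taylor transform exists and is zero: the Taylor
coefficients at `0`, each divided by `r ^ k`, of `exp (-(1 - z) ^ (-1/2))`, which is smooth on the
closed unit disc and flat at `z = 1`.) -/
abbrev TaylorSpace (𝕜 : Type*) [RCLike 𝕜] (r : ℝ) (p : ℝ≥0∞) [Fact (1 ≤ p)] : Type _ :=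
  SeparationQuotient (TaylorSeq 𝕜 r p)

/-- The weak fixed point property of a normed space: every nonexpansive self-map of a nonempty
weakly compact convex subset has a fixed point. -/
def WeakFixedPointProperty (𝕜 : Type*) [RCLike 𝕜] (X : Type*) [NormedAddCommGroup X]
    [NormedSpace 𝕜 X] : Prop :=
  ∀ C : Set X, C.Nonempty →
    (∀ x ∈ C, ∀ y ∈ C, ∀ a b : ℝ, 0 ≤ a → 0 ≤ b → a + b = 1 → (a : 𝕜) • x + (b : 𝕜) • y ∈ C) →
    IsCompact (toWeakSpace 𝕜 X '' C) →
    ∀ F : C → C, (∀ x y : C, ‖(F x : X) - (F y : X)‖ ≤ ‖(x : X) - (y : X)‖) →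
      ∃ x : C, F x = x

end

open Bornology

/-! The map `x ↦ T(r)x` embeds `t_p^r` linearly and isometrically into `ℓ_p`, and such an embedding
carries weakly compact convex sets to weakly compact convex sets. So it suffices to treat `ℓ_p`;
neither surjectivity of `T(r)` nor completeness of `t_p^r` is needed.

In `ℓ_p` the argument is Opial's. A nonexpansive `F` on `C` has approximate fixed points `u n`; let
`x` be a weak limit of them along an ultrafilter. Then `‖u n - F x‖ ≤ ‖u n - x‖ + o(1)`. But if `z n
→ 0` coordinatewise, then `‖z n - w‖ ^ p - ‖z n‖ ^ p → ‖w‖ ^ p`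
(`lp.tendsto_norm_sub_sum_single_rpow` for finitely supported `w`), so moving the centre from `x` to
`F x` has a strictly positive cost unless `F x = x` (`lp.eq_zero_of_norm_sub_le`). -/

/-- The weak topology of a normed space is Hausdorff. -/
theorem WeakSpace.t2Space_of_normedSpace (𝕜 X : Type*) [RCLike 𝕜] [NormedAddCommGroup X]
    [NormedSpace 𝕜 X] : T2Space (WeakSpace 𝕜 X) :=
  (NormedSpace.isEmbedding_inclusionInDoubleDualWeak 𝕜 X).t2Space

/-- Weakly compact sets are norm closed. -/
theorem isClosed_of_isCompact_toWeakSpace_image {𝕜 X : Type*} [RCLike 𝕜] [NormedAddCommGroup X]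
    [NormedSpace 𝕜 X] {C : Set X} (hC : IsCompact (toWeakSpace 𝕜 X '' C)) : IsClosed C := by
  have := WeakSpace.t2Space_of_normedSpace 𝕜 X
  have h := hC.isClosed.preimage (toWeakSpaceCLM 𝕜 X).continuous
  have hpre : (toWeakSpaceCLM 𝕜 X) ⁻¹' (toWeakSpace 𝕜 X '' C) = C :=
    Set.preimage_image_eq C (toWeakSpace 𝕜 X).injective
  rwa [hpre] at h

/-- Weakly compact sets are bounded. -/
theorem isBounded_of_isCompact_toWeakSpace_image {𝕜 X : Type*} [RCLike 𝕜] [NormedAddCommGroup X]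
    [NormedSpace 𝕜 X] {C : Set X} (hC : IsCompact (toWeakSpace 𝕜 X '' C)) : IsBounded C := by
  -- `C` acts on the dual, which is complete even if `X` is not; each `f` is weakly continuous,
  -- hence bounded on `C`.
  obtain ⟨M, hM⟩ := banach_steinhaus
    (g := fun x : C => NormedSpace.inclusionInDoubleDual 𝕜 X (x : X)) fun f => by
      have hf : Continuous fun x : WeakSpace 𝕜 X => f ((toWeakSpace 𝕜 X).symm x) :=
        WeakBilin.eval_continuous _ f
      obtain ⟨B, hB⟩ := (hC.image hf).isBounded.exists_norm_le
      refine ⟨B, fun x => hB _ ?_⟩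
      exact ⟨toWeakSpace 𝕜 X x, ⟨x, x.2, rfl⟩, rfl⟩
  refine isBounded_iff_forall_norm_le.2 ⟨M, fun x hx => ?_⟩
  rw [← (NormedSpace.inclusionInDoubleDualLi (E := X) 𝕜).norm_map x]
  exact hM ⟨x, hx⟩

/-- The weak fixed point property passes to linear isometric copies of subspaces. -/
theorem WeakFixedPointProperty.of_linearIsometry {𝕜 X Y : Type*} [RCLike 𝕜]
    [NormedAddCommGroup X] [NormedSpace 𝕜 X] [NormedAddCommGroup Y] [NormedSpace 𝕜 Y]
    (j : X →ₗᵢ[𝕜] Y) (hY : WeakFixedPointProperty 𝕜 Y) : WeakFixedPointProperty 𝕜 X := by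
  intro C hne hconv hC F hF
  let e : C ≃ j '' C := Equiv.Set.image j C j.injective
  have he : ∀ x : C, (e x : Y) = j x := fun x => rfl
  have hes : ∀ y, j (e.symm y : X) = y := fun y => by rw [← he, e.apply_symm_apply]
  obtain ⟨y, hy⟩ := hY (j '' C) (hne.image j) (by
      rintro _ ⟨x, hx, rfl⟩ _ ⟨y, hy, rfl⟩ a b ha hb hab
      exact ⟨_, hconv x hx y hy a b ha hb hab, by simp⟩) (by
      have h := hC.image (WeakSpace.map j.toContinuousLinearMap).continuous
      rw [Set.image_image] at h
      rw [Set.image_image]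
      exact h) (fun y => e (F (e.symm y))) (fun x y => by
      rw [he, he, ← map_sub, j.norm_map, ← hes x, ← hes y, ← map_sub, j.norm_map]
      simpa only [hes, Subtype.coe_eta] using hF (e.symm x) (e.symm y))
  exact ⟨e.symm y, by rw [Equiv.eq_symm_apply]; exact hy⟩

/-- A nonexpansive self-map of a nonempty complete bounded convex set has a sequence of approximate
fixed points. -/
theorem exists_seq_tendsto_norm_sub_of_nonexpansive {𝕜 X : Type*} [RCLike 𝕜]
    [NormedAddCommGroup X] [NormedSpace 𝕜 X] {C : Set X} (hne : C.Nonempty)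
    (hconv : ∀ x ∈ C, ∀ y ∈ C, ∀ a b : ℝ, 0 ≤ a → 0 ≤ b → a + b = 1 →
      (a : 𝕜) • x + (b : 𝕜) • y ∈ C)
    (hcomp : IsComplete C) (hbdd : IsBounded C) (F : C → C)
    (hF : ∀ x y : C, ‖(F x : X) - (F y : X)‖ ≤ ‖(x : X) - (y : X)‖) :
    ∃ u : ℕ → C, Tendsto (fun n => ‖(u n : X) - F (u n)‖) atTop (𝓝 0) := by
  have := hcomp.completeSpace_coe
  have := hne.to_subtype
  obtain ⟨x₀⟩ := this
  obtain ⟨M, hM⟩ := hbdd.exists_norm_le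
  have key : ∀ n : ℕ, ∃ x : C, ‖(x : X) - F x‖ ≤ 1 / ((n : ℝ) + 1) * (M + M) := by
    intro n
    set t : ℝ := 1 / ((n : ℝ) + 1) with ht
    have ht0 : 0 < t := by positivity
    have ht1 : t ≤ 1 := by
      rw [ht, div_le_one (by positivity)]
      linarith [n.cast_nonneg (α := ℝ)]
    -- Pulling `F` towards `x₀` with weight `t` gives a contraction of ratio `1 - t`; at its fixed
    -- point, `x - F x = t • (x₀ - F x)`, which is `O(t)` as `C` is bounded.
    let G : C → C := fun x =>
      ⟨((1 - t : ℝ) : 𝕜) • (F x : X) + (t : 𝕜) • (x₀ : X),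
        hconv _ (F x).2 _ x₀.2 _ _ (by linarith) ht0.le (by ring)⟩
    have hG : ContractingWith (1 - t).toNNReal G := by
      refine ⟨by rw [← NNReal.coe_lt_coe, Real.coe_toNNReal _ (by linarith)]; simpa using ht0,
        LipschitzWith.of_dist_le_mul fun x y => ?_⟩
      rw [Real.coe_toNNReal _ (by linarith), Subtype.dist_eq, Subtype.dist_eq, dist_eq_norm,
        dist_eq_norm, add_sub_add_right_eq_sub, ← smul_sub, norm_smul, RCLike.norm_ofReal,
        abs_of_nonneg (by linarith)]
      exact mul_le_mul_of_nonneg_left (hF x y) (by linarith)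
    have : Nonempty C := ⟨x₀⟩
    refine ⟨ContractingWith.fixedPoint G hG, ?_⟩
    have hx := congrArg Subtype.val hG.fixedPoint_isFixedPt
    set x := ContractingWith.fixedPoint G hG
    have hx' : (x : X) - F x = (t : 𝕜) • ((x₀ : X) - F x) := by
      nth_rewrite 1 [← hx]
      simp only [G, RCLike.ofReal_sub, RCLike.ofReal_one, sub_smul, smul_sub, one_smul]
      abel
    rw [hx', norm_smul, RCLike.norm_ofReal, abs_of_pos ht0]
    refine mul_le_mul_of_nonneg_left ((norm_sub_le _ _).trans ?_) ht0.le
    exact add_le_add (hM _ x₀.2) (hM _ (F x).2)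
  choose u hu using key
  refine ⟨u, squeeze_zero (fun _ => norm_nonneg _) hu ?_⟩
  simpa using tendsto_one_div_add_atTop_nhds_zero_nat.mul_const (M + M)

/-- If `z i → 0` coordinatewise, translation by a finitely supported vector asymptotically adds its
`p`-th power to the `p`-th power of the norm. -/
theorem lp.tendsto_norm_sub_sum_single_rpow {α ι : Type*} [DecidableEq α] {E : α → Type*}
    [∀ i, NormedAddCommGroup (E i)] {p : ℝ≥0∞} [Fact (1 ≤ p)]
    (hp : 0 < p.toReal) {l : Filter ι} {z : ι → lp E p}
    (hz : ∀ k, Tendsto (fun i => z i k) l (𝓝 0)) (w : ∀ k, E k) (s : Finset α) :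
    Tendsto (fun i => ‖z i - ∑ k ∈ s, lp.single p k (w k)‖ ^ p.toReal - ‖z i‖ ^ p.toReal) l
      (𝓝 (‖∑ k ∈ s, lp.single p k (w k)‖ ^ p.toReal)) := by
  rw [lp.norm_sum_single hp]
  have hcoe : ∀ k, (∑ k ∈ s, lp.single p k (w k) : lp E p) k = if k ∈ s then w k else 0 := by
    intro k
    simp only [lp.coeFn_sum, lp.coeFn_single, Finset.sum_apply, Finset.sum_pi_single]
  -- Off `s` the two series have equal terms, so only a finite sum remains and coordinatewise
  -- convergence suffices.
  have hdiff : ∀ i, ‖z i - ∑ k ∈ s, lp.single p k (w k)‖ ^ p.toReal - ‖z i‖ ^ p.toReal =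
      ∑ k ∈ s, (‖z i k - w k‖ ^ p.toReal - ‖z i k‖ ^ p.toReal) := by
    intro i
    refine ((lp.hasSum_norm hp (z i - ∑ k ∈ s, lp.single p k (w k))).sub
      (lp.hasSum_norm hp (z i))).unique ?_
    have hsum : ∑ k ∈ s, (‖z i k - w k‖ ^ p.toReal - ‖z i k‖ ^ p.toReal) =
        ∑ k ∈ s, (‖(z i - ∑ k ∈ s, lp.single p k (w k) : lp E p) k‖ ^ p.toReal
          - ‖z i k‖ ^ p.toReal) :=
      Finset.sum_congr rfl fun k hk => by rw [lp.coeFn_sub, Pi.sub_apply, hcoe, if_pos hk]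
    rw [hsum]
    exact hasSum_sum_of_ne_finset_zero fun k hk => by
      rw [lp.coeFn_sub, Pi.sub_apply, hcoe, if_neg hk, sub_zero, sub_self]
  simp only [hdiff]
  refine tendsto_finsetSum _ fun k _ => ?_
  have h1 := (((hz k).sub_const (w k)).norm.rpow_const (p := p.toReal) (Or.inr hp.le)).sub
    ((hz k).norm.rpow_const (p := p.toReal) (Or.inr hp.le))
  simpa [Real.zero_rpow hp.ne'] using h1

/-- Opial's property of `ℓ_p`: the coordinatewise limit is the only asymptotic centre. -/
theorem lp.eq_zero_of_norm_sub_le {α ι : Type*} {E : α → Type*}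
    [∀ i, NormedAddCommGroup (E i)] {p : ℝ≥0∞} [Fact (1 ≤ p)] (hp : p ≠ ∞) {l : Filter ι} [l.NeBot]
    {z : ι → lp E p} (hz : ∀ k, Tendsto (fun i => z i k) l (𝓝 0)) {L : ℝ}
    (hL : Tendsto (fun i => ‖z i‖) l (𝓝 L)) {e : ι → ℝ} (he : Tendsto e l (𝓝 0)) {w : lp E p}
    (hw : ∀ i, ‖z i - w‖ ≤ ‖z i‖ + e i) : w = 0 := by
  classical
  have hp0 : 0 < p.toReal :=
    ENNReal.toReal_pos (zero_lt_one.trans_le (Fact.out : 1 ≤ p)).ne' hp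
  have hL0 : 0 ≤ L := ge_of_tendsto' hL fun i => norm_nonneg _
  -- Finite truncations of `w`: the limit in `i` is taken for fixed `s` with error `‖w - v s‖`,
  -- which vanishes as `s` grows because `p ≠ ∞`.
  let v : Finset α → lp E p := fun s => ∑ k ∈ s, lp.single p k (w k)
  have hv : Tendsto v atTop (𝓝 w) := lp.hasSum_single hp w
  have hs : ∀ s, L ^ p.toReal + ‖v s‖ ^ p.toReal ≤ (L + ‖w - v s‖) ^ p.toReal := by
    intro s
    have h1 := (hL.rpow_const (p := p.toReal) (Or.inr hp0.le)).add
      (lp.tendsto_norm_sub_sum_single_rpow hp0 hz (fun k => w k) s)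
    have h2 : Tendsto (fun i => (‖z i‖ + e i + ‖w - v s‖) ^ p.toReal) l
        (𝓝 ((L + 0 + ‖w - v s‖) ^ p.toReal)) :=
      ((hL.add he).add_const _).rpow_const (Or.inr hp0.le)
    rw [add_zero] at h2
    refine le_of_tendsto_of_tendsto' h1 h2 fun i => ?_
    rw [add_sub_cancel]
    refine Real.rpow_le_rpow (norm_nonneg _) ?_ hp0.le
    calc ‖z i - v s‖ = ‖(z i - w) + (w - v s)‖ := by rw [sub_add_sub_cancel]
      _ ≤ ‖z i - w‖ + ‖w - v s‖ := norm_add_le _ _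
      _ ≤ _ := by linarith [hw i]
  have h1 : Tendsto (fun s => L ^ p.toReal + ‖v s‖ ^ p.toReal) atTop
      (𝓝 (L ^ p.toReal + ‖w‖ ^ p.toReal)) :=
    (hv.norm.rpow_const (Or.inr hp0.le)).const_add _
  have h2 : Tendsto (fun s => (L + ‖w - v s‖) ^ p.toReal) atTop
      (𝓝 ((L + ‖w - w‖) ^ p.toReal)) :=
    (((hv.const_sub w).norm).const_add L).rpow_const (Or.inr hp0.le)
  -- In the limit, `L ^ p + ‖w‖ ^ p ≤ L ^ p`.
  have h := le_of_tendsto_of_tendsto' h1 h2 hs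
  rw [sub_self, norm_zero, add_zero] at h
  have hw0 : ‖w‖ ^ p.toReal = 0 :=
    le_antisymm (by linarith) (Real.rpow_nonneg (norm_nonneg _) _)
  exact norm_eq_zero.1 ((Real.rpow_eq_zero (norm_nonneg _) hp0.ne').1 hw0)

/-- `ℓ_p` has the weak fixed point property for `1 ≤ p < ∞`. -/
theorem lp.weakFixedPointProperty (𝕜 : Type*) [RCLike 𝕜] (α : Type*) (p : ℝ≥0∞) [Fact (1 ≤ p)]
    (hp : p ≠ ∞) : WeakFixedPointProperty 𝕜 (lp (fun _ : α => 𝕜) p) := by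
  intro C hne hconv hC F hF
  have hbdd := isBounded_of_isCompact_toWeakSpace_image hC
  obtain ⟨u, hu⟩ := exists_seq_tendsto_norm_sub_of_nonexpansive hne hconv
    (isClosed_of_isCompact_toWeakSpace_image hC).isComplete hbdd F hF
  -- One ultrafilter makes both `u n` (weakly) and `‖u n - x‖` converge, with no weak sequential
  -- compactness or passage to subsequences.
  let U : Ultrafilter ℕ := hyperfilter ℕ
  have hU : (U : Filter ℕ) ≤ atTop := by
    rw [← Nat.cofinite_eq_atTop]
    exact hyperfilter_le_cofinite
  obtain ⟨_, ⟨x, hx, rfl⟩, hlim⟩ := hC.ultrafilter_le_nhds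
    (U.map fun n => toWeakSpace 𝕜 _ (u n : lp (fun _ : α => 𝕜) p))
    (le_principal_iff.2 (Filter.mem_map.2 (Filter.univ_mem' fun n => ⟨u n, (u n).2, rfl⟩)))
  have hcoord : ∀ k, Tendsto (fun n => ((u n : lp (fun _ : α => 𝕜) p) - x) k) U (𝓝 0) := by
    intro k
    let f : StrongDual 𝕜 (lp (fun _ : α => 𝕜) p) := lp.evalCLM 𝕜 (fun _ : α => 𝕜) p k
    have hf : Continuous fun y : WeakSpace 𝕜 (lp (fun _ : α => 𝕜) p) =>
        f ((toWeakSpace 𝕜 _).symm y) := WeakBilin.eval_continuous _ f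
    have h : Tendsto (fun n => (u n : lp (fun _ : α => 𝕜) p) k) U (𝓝 (x k)) :=
      (hf.tendsto (toWeakSpace 𝕜 _ x)).comp hlim
    simpa using h.sub_const (x k)
  obtain ⟨M, hM⟩ := hbdd.exists_norm_le
  obtain ⟨L, -, hL⟩ := (isCompact_Icc (a := (0 : ℝ)) (b := M + M)).ultrafilter_le_nhds
    (U.map fun n => ‖(u n : lp (fun _ : α => 𝕜) p) - x‖)
    (le_principal_iff.2 (Filter.mem_map.2 (Filter.univ_mem' fun n => ⟨norm_nonneg _,
      (norm_sub_le _ _).trans (add_le_add (hM _ (u n).2) (hM _ hx))⟩)))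
  refine ⟨⟨x, hx⟩, Subtype.ext (sub_eq_zero.1 ?_)⟩
  -- Opial's property with `w = F x - x` and error `‖u n - F (u n)‖`.
  refine lp.eq_zero_of_norm_sub_le hp hcoord hL (hu.mono_left hU) fun n => ?_
  calc ‖(u n : lp (fun _ : α => 𝕜) p) - x - (F ⟨x, hx⟩ - x)‖
      = ‖((F (u n) : lp (fun _ : α => 𝕜) p) - F ⟨x, hx⟩) + (u n - F (u n))‖ := by
        congr 1; abel
    _ ≤ _ := norm_add_le _ _
    _ ≤ _ := by gcongr; exact hF (u n) ⟨x, hx⟩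

/-- The linear isometry `x ↦ T(r)x` from the sequences in `t_p^r` to `ℓ_p`. -/
noncomputable def TaylorSeq.toLpLI (𝕜 : Type*) [RCLike 𝕜] (r : ℝ) (p : ℝ≥0∞) [Fact (1 ≤ p)] :
    TaylorSeq 𝕜 r p →ₗᵢ[𝕜] lp (fun _ : ℕ => 𝕜) p where
  toLinearMap := TaylorSeq.toLp 𝕜 r p
  norm_map' _ := rfl

/-- The linear isometry `x ↦ T(r)x` from the normed space `t_p^r` to `ℓ_p`. -/
noncomputable def TaylorSpace.toLpLI (𝕜 : Type*) [RCLike 𝕜] (r : ℝ) (p : ℝ≥0∞) [Fact (1 ≤ p)] :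
    TaylorSpace 𝕜 r p →ₗᵢ[𝕜] lp (fun _ : ℕ => 𝕜) p where
  -- Inseparable sequences have inseparable images, which are equal since `ℓ_p` is Hausdorff.
  toLinearMap := (SeparationQuotient.liftCLM (TaylorSeq.toLpLI 𝕜 r p).toContinuousLinearMap
    fun x y h => (h.map (TaylorSeq.toLpLI 𝕜 r p).continuous).eq).toLinearMap
  norm_map' := by
    intro x
    obtain ⟨x, rfl⟩ := SeparationQuotient.surjective_mk x
    rfl

theorem mainTheorem9 (𝕜 : Type*) [RCLike 𝕜] (r : ℝ) (hr0 : 0 < r) (hr1 : r < 1)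
    (p : ℝ≥0∞) [Fact (1 ≤ p)] (hp1 : 1 < p) (hp : p < ∞) :
    WeakFixedPointProperty 𝕜 (TaylorSpace 𝕜 r p) :=
  (lp.weakFixedPointProperty 𝕜 ℕ p hp.ne).of_linearIsometry (TaylorSpace.toLpLI 𝕜 r p)
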